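/- A \emph{two-counter machine} (TCM) is a finite program with two counters $x\in\{x_1,x_2\}$ holding natural numbers, built from the commands $x\leftarrow x+1$, $x\leftarrow x-1$ (an empty counter stays empty), "if $x=0$ then goto $l$", "goto $l$" and "halt". It \emph{computes} a total function $f:\mathbb N\to\mathbb N$ if for every $n\in\mathbb N$, started with $n$ in a fixed one of its counters and $0$ in the other, it halts with $f(n)$ in one of the counters and $0$ in the other. A \emph{two-counter machine with input} (TCMI) over a finite alphabet is such a program which may in addition contain wait states, at which the next input symbol $d$ is consumed and the program branches according to $d$ ("if $I=d$ goto $l$"). For an input string $I$ we say that a TCMI $M$ reaches a configuration $(w,m_1,m_2)$ on $I$, written $M\vdash^{I}(w,m_1,m_2)$, if $M$, started at its initial line with both counters empty and being input $I$, gets to the line $w$ with counter contents $m_1,m_2$ after all of $I$ has been consumed (it need not halt there, and there is no stop marker after $I$). For a radix $b\ge 2$ and a string $I=d_0d_1\cdots d_{k-1}$ of digits $0\le d_i<b$, put $\ulcorner I\urcorner=\sum_{i<k}d_ib^i$, so that the digits are input least significant first. \textbf{Theorem.} Let $f:\mathbb N\to\mathbb N$ be a total function with unbounded range that is computed by some TCM.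 Then for every radix $b\ge 2$ there is no TCMI $M$ over the alphabet $\{0,\dots,b-1\}$ such that for every string $I$ of radix-$b$ digits there is a line $w$ with $M\vdash^{I}(w,f(\ulcorner I\urcorner),0)$ or $M\vdash^{I}(w,0,f(\ulcorner I\urcorner))$. -/

import Mathlib

namespace MinskyInput

/-- The contents of the two counters. -/
abbrev Counters : Type := Fin 2 → ℕ

/-- The commands of the two-counter language over a set `Q` of program lines. Every command
names the line (or lines) at which the program continues. -/
inductive Instr (Q : Type) : Type
  /-- `x ← x + 1`, then continue at `next`. -/
  | inc (x : Fin 2) (next : Q)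
  /-- `x ← x - 1` (an empty counter stays empty), then continue at `next`. -/
  | dec (x : Fin 2) (next : Q)
  /-- `if x = 0 then goto target`, otherwise continue at `next`. -/
  | ifZero (x : Fin 2) (target next : Q)
  /-- `goto target`. -/
  | goto (target : Q)
  /-- `halt`. -/
  | halt

/-- The effect of a command on the counters: the next line and the new counter contents,
or `none` for `halt`. -/
def Instr.exec {Q : Type} : Instr Q → Counters → Option (Q × Counters)
  | .inc x next, n => some (next, Function.update n x (n x + 1))
  | .dec x next, n => some (next, Function.update n x (n x - 1))
  | .ifZero x target next, n => some (if n x = 0 then target else next, n)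
  | .goto target, n => some (target, n)
  | .halt, _ => none

/-- A two-counter Minsky machine: a finite program in the two-counter language. -/
structure TCM where
  /-- The program lines (states). -/
  Q : Type
  finite_Q : Finite Q
  /-- The line at which the program starts. -/
  start : Q
  /-- The command at every line. -/
  code : Q → Instr Q

/-- One step of a two-counter machine. -/
def TCM.Step (M : TCM) (c c' : M.Q × Counters) : Prop :=
  (M.code c.1).exec c.2 = some c'

/-- `M` computes the total function `f`: for a fixed counter `i` and every `n`, started with `n`
in counter `i` and `0` in the other one, `M` halts with `f n` in one of the counters and `0` in
the other. (`Pi.single j v` is the content `v` of counter `j` with the other counter empty.) -/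
def TCM.Computes (M : TCM) (f : ℕ → ℕ) : Prop :=
  ∃ i : Fin 2, ∀ n : ℕ, ∃ c : M.Q × Counters,
    Relation.ReflTransGen M.Step (M.start, Pi.single i n) c ∧
    M.code c.1 = Instr.halt ∧
    ∃ j : Fin 2, c.2 = Pi.single j (f n)

/-- The commands of a two-counter machine with input from the alphabet `α`. -/
inductive InputInstr (α Q : Type) : Type
  /-- A command of the two-counter language. -/
  | op (o : Instr Q)
  /-- The commands `if I = d goto target d`, one for each `d`. A line with such a command is a
  wait state: the machine waits for the next input symbol and consumes it. -/
  | input (target : α → Q)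

/-- A two-counter Minsky machine with input from the alphabet `α`. -/
structure TCMI (α : Type) where
  /-- The program lines (states). -/
  Q : Type
  finite_Q : Finite Q
  /-- The line at which the program starts. -/
  start : Q
  /-- The command at every line. -/
  code : Q → InputInstr α Q

/-- One step of a machine with input. The last component is the part of the input that has not
been consumed yet. At a wait state with no input left there is no step. -/
inductive TCMI.Step {α : Type} (M : TCMI α) :
    M.Q × Counters × List α → M.Q × Counters × List α → Prop
  | op {q q' : M.Q} {n n' : Counters} {I : List α} {o : Instr M.Q}
      (hq : M.code q = InputInstr.op o) (ho : o.exec n = some (q', n')) :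
      M.Step (q, n, I) (q', n', I)
  | input {q : M.Q} {n : Counters} {d : α} {I : List α} {target : α → M.Q}
      (hq : M.code q = InputInstr.input target) :
      M.Step (q, n, d :: I) (target d, n, I)

/-- Started at its first line with empty counters and being input the string `I`, the machine
reaches (not necessarily halting there) the line `w` with counter contents `m`, after it has
consumed all of `I`. -/
def TCMI.Reaches {α : Type} (M : TCMI α) (I : List α) (w : M.Q) (m : Counters) : Prop :=
  Relation.ReflTransGen M.Step (M.start, 0, I) (w, m, [])

/-- The value of a string of radix `b` digits, least significant digit first. -/
def digitValue {b : ℕ} (I : List (Fin b)) : ℕ :=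
  Nat.ofDigits b (I.map Fin.val)

/-- On every string of radix `b` digits presented least significant digit first (leading zeros
of the number being allowed), with no stop marker, `M` reaches a configuration with the value of
`f` in one of the counters and `0` in the other. -/
def TCMI.ComputesOnline {b : ℕ} (M : TCMI (Fin b)) (f : ℕ → ℕ) : Prop :=
  ∀ I : List (Fin b), ∃ (w : M.Q) (j : Fin 2), M.Reaches I w (Pi.single j (f (digitValue I)))

end MinskyInput

/-! The growth of `f` on an arithmetic progression clashes with a finiteness bound for online
machines. Halting runs through configurations with both counters small yield only finitely many
outputs. A run with any other output splits at the moments when a counter is empty. Each piece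
either lets its counter carry extra units, or repeats a loop that trades α units of one counter for
β of the other. So `f` is affine and nonconstant on some n + d·t (`TCM.Computes.exists_affine`).
Online, zeros padded after the digits of n leave the value n, so infinitely many paddings share one
configuration. The single run from there on the digits of d meets every f(n + b^(|I|+k)·d) for these
k, but visits finitely many configurations before it consumes another symbol. Two of these values
agree (`TCMI.ComputesOnline.exists_value_eq`), against injectivity on the progression. -/

namespace MinskyInput

open Relation Relator

/-! ### Runs of deterministic relations -/

section General

variable {σ : Type*} {r : σ → σ → Prop}

theorem exists_run_of_reflTransGen {a b : σ} (h : ReflTransGen r a b) :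
    ∃ (N : ℕ) (c : ℕ → σ), c 0 = a ∧ c N = b ∧ ∀ k < N, r (c k) (c (k + 1)) := by
  induction h with
  | refl => exact ⟨0, fun _ => a, rfl, rfl, by simp⟩
  | @tail b' b'' _ hr ih =>
    obtain ⟨N, c, h0, hN, hc⟩ := ih
    refine ⟨N + 1, fun k => if k ≤ N then c k else b'', by simp [h0], by simp, fun k hk => ?_⟩
    rcases Nat.lt_succ_iff_lt_or_eq.mp hk with hk | rfl
    · have h1 : k ≤ N := hk.le
      have h2 : k + 1 ≤ N := hk
      simpa [h1, h2] using hc k hk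
    · simpa [hN] using hr

theorem reflTransGen_of_run {c : ℕ → σ} {i j : ℕ} (hij : i ≤ j)
    (hc : ∀ k, i ≤ k → k < j → r (c k) (c (k + 1))) : ReflTransGen r (c i) (c j) := by
  induction j, hij using Nat.le_induction with
  | base => exact .refl
  | succ j hij ih =>
    exact (ih fun k h1 h2 => hc k h1 (by omega)).tail (hc j hij (by omega))

/-- In a deterministic system only finitely many configurations are visited before a
configuration that is reached. -/
theorem finite_setOf_reached_before (hr : RightUnique r) {a e : σ} (h : ReflTransGen r a e) :
    {x | ReflTransGen r a x ∧ ¬ ReflTransGen r e x}.Finite := by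
  induction h using ReflTransGen.head_induction_on with
  | refl => simp
  | @head a a' h1 _ ih =>
    refine (ih.insert a).subset fun x ⟨hx, hex⟩ => ?_
    rcases ReflTransGen.cases_head hx with rfl | ⟨a'', h2, h3⟩
    · exact Set.mem_insert _ _
    · obtain rfl := hr h1 h2
      exact Set.mem_insert_of_mem _ ⟨h3, hex⟩

end General

/-! ### Single steps and translation of counters -/

theorem exists_single_of_eq_zero {n : Counters} {j : Fin 2} (h : n j = 0) :
    ∃ i m, n = Pi.single i m := by
  refine ⟨1 - j, n (1 - j), ?_⟩
  funext k
  fin_cases j <;> fin_cases k <;> simp_all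

theorem single_value_injective {i j : Fin 2} {m m' : ℕ}
    (h : (Pi.single i m : Counters) = Pi.single j m') : m = m' := by
  have := congrArg (fun n : Counters => ∑ k, n k) h
  simpa using this

theorem TCM.step_rightUnique (M : TCM) : RightUnique M.Step := by
  intro a b c hab hac
  have := hab.symm.trans hac
  simpa using this

/-- Zero tests and truncated decrements only distinguish zero from nonzero, so units added to a
nonempty counter go unnoticed. -/
theorem TCM.Step.shift {M : TCM} {q q' : M.Q} {n n' : Counters} (h : M.Step (q, n) (q', n'))
    (v : Counters) (hv : ∀ j, v j ≠ 0 → n j ≠ 0) : M.Step (q, n + v) (q', n' + v) := by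
  unfold TCM.Step at h ⊢
  simp only at h ⊢
  cases hq : M.code q with
  | inc x next =>
    simp only [hq, Instr.exec, Option.some.injEq, Prod.mk.injEq] at h ⊢
    obtain ⟨rfl, rfl⟩ := h
    refine ⟨rfl, funext fun j => ?_⟩
    by_cases hj : j = x
    · subst hj; simp; omega
    · simp [hj]
  | dec x next =>
    simp only [hq, Instr.exec, Option.some.injEq, Prod.mk.injEq] at h ⊢
    obtain ⟨rfl, rfl⟩ := h
    refine ⟨rfl, funext fun j => ?_⟩
    have := hv x
    by_cases hj : j = x
    · subst hj; simp; omega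
    · simp [hj]
  | ifZero x target next =>
    simp only [hq, Instr.exec, Option.some.injEq, Prod.mk.injEq] at h ⊢
    obtain ⟨rfl, rfl⟩ := h
    have := hv x
    refine ⟨?_, rfl⟩
    have : (n + v) x = 0 ↔ n x = 0 := by simp only [Pi.add_apply]; omega
    simp only [this]
  | goto target =>
    simp only [hq, Instr.exec, Option.some.injEq, Prod.mk.injEq] at h ⊢
    exact ⟨h.1, by rw [h.2]⟩
  | halt => simp [hq, Instr.exec] at h

theorem TCM.Step.apply_le {M : TCM} {c c' : M.Q × Counters} (h : M.Step c c') (j : Fin 2) :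
    c'.2 j ≤ c.2 j + 1 := by
  obtain ⟨q, n⟩ := c
  obtain ⟨q', n'⟩ := c'
  unfold TCM.Step at h
  simp only at h ⊢
  cases hq : M.code q with
  | inc x next =>
    simp only [hq, Instr.exec, Option.some.injEq, Prod.mk.injEq] at h
    obtain ⟨rfl, rfl⟩ := h
    by_cases hj : j = x
    · subst hj; simp
    · simp [hj]
  | dec x next =>
    simp only [hq, Instr.exec, Option.some.injEq, Prod.mk.injEq] at h
    obtain ⟨rfl, rfl⟩ := h
    by_cases hj : j = x
    · subst hj; simp; omega
    · simp [hj]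
  | ifZero x target next =>
    simp only [hq, Instr.exec, Option.some.injEq, Prod.mk.injEq] at h
    simp [h.2]
  | goto target =>
    simp only [hq, Instr.exec, Option.some.injEq, Prod.mk.injEq] at h
    simp [h.2]
  | halt => simp [hq, Instr.exec] at h

/-- Where both counters are positive, the line determines the next line and the change of the
counters. -/
theorem TCM.Step.parallel {M : TCM} {q q₁ q₂ : M.Q} {n n₁ p p₂ : Counters}
    (h₁ : M.Step (q, n) (q₁, n₁)) (h₂ : M.Step (q, p) (q₂, p₂))
    (hn : ∀ j, n j ≠ 0) (hp : ∀ j, p j ≠ 0) : q₁ = q₂ ∧ n₁ + p = p₂ + n := by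
  have e₁ := h₁.shift p fun j _ => hn j
  have e₂ := h₂.shift n fun j _ => hp j
  rw [add_comm p n] at e₂
  simpa using M.step_rightUnique e₁ e₂

/-! ### Translation and repetition of runs -/

section Run

variable {M : TCM} {c : ℕ → M.Q × Counters}

theorem reflTransGen_run_shift {i j : ℕ} (hij : i ≤ j)
    (hc : ∀ k, i ≤ k → k < j → M.Step (c k) (c (k + 1))) (v : Counters)
    (hv : ∀ k, i ≤ k → k < j → ∀ l, v l ≠ 0 → (c k).2 l ≠ 0) :
    ReflTransGen M.Step ((c i).1, (c i).2 + v) ((c j).1, (c j).2 + v) :=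
  reflTransGen_of_run (c := fun k => ((c k).1, (c k).2 + v)) hij fun k h1 h2 =>
    (hc k h1 h2).shift v (hv k h1 h2)

theorem run_apply_le {N : ℕ} (hc : ∀ k < N, M.Step (c k) (c (k + 1))) {j : Fin 2}
    (h0 : (c 0).2 j = 0) : ∀ k ≤ N, (c k).2 j ≤ k := by
  intro k
  induction k with
  | zero => simp [h0]
  | succ k ih =>
    intro hk
    have h1 := ih (by omega)
    have h2 := (hc k (by omega)).apply_le j
    omega

/-- While both counters are positive the line alone drives the machine, so one repeated line makes
all later lines periodic, with a fixed counter change per period. -/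
theorem run_periodic {N i L : ℕ} (hc : ∀ k < N, M.Step (c k) (c (k + 1)))
    (hpos : ∀ k, i ≤ k → k < N → ∀ l, (c k).2 l ≠ 0) (hq : (c (i + L)).1 = (c i).1) :
    ∀ k, i ≤ k → k + L ≤ N →
      (c (k + L)).1 = (c k).1 ∧ (c (k + L)).2 + (c i).2 = (c (i + L)).2 + (c k).2 := by
  intro k hk
  induction k, hk using Nat.le_induction with
  | base => exact fun _ => ⟨hq, rfl⟩
  | succ k hk ih =>
    intro hkN
    obtain ⟨h1, h2⟩ := ih (by omega)
    have s1 : M.Step ((c k).1, (c (k + L)).2) ((c (k + L + 1)).1, (c (k + L + 1)).2) := by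
      rw [← h1]; exact hc (k + L) (by omega)
    have s2 : M.Step ((c k).1, (c k).2) ((c (k + 1)).1, (c (k + 1)).2) := hc k (by omega)
    obtain ⟨h3, h4⟩ := s1.parallel s2 (hpos _ (by omega) (by omega)) (hpos _ (by omega) (by omega))
    rw [show k + 1 + L = k + L + 1 by ring]
    refine ⟨h3, ?_⟩
    funext l
    have h2 := congrFun h2 l
    have h4 := congrFun h4 l
    simp only [Pi.add_apply] at h2 h4 ⊢
    omega

/-- Copies of `A` not yet traded and copies of `B` already gained ride along in `v`. -/
theorem reflTransGen_cycle {q : M.Q} {n A B : Counters}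
    (h : ∀ v, ReflTransGen M.Step (q, n + A + v) (q, n + B + v)) (t : ℕ) :
    ∀ v, ReflTransGen M.Step (q, n + t • A + v) (q, n + t • B + v) := by
  induction t with
  | zero => intro v; simp [ReflTransGen.refl]
  | succ t ih =>
    intro v
    have h1 := h (t • A + v)
    have h2 := ih (B + v)
    have e1 : n + (t + 1) • A + v = n + A + (t • A + v) := by rw [succ_nsmul]; abel
    have e2 : n + t • A + (B + v) = n + B + (t • A + v) := by abel
    have e3 : n + (t + 1) • B + v = n + t • B + (B + v) := by rw [succ_nsmul]; abel
    rw [e1, e3]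
    rw [e2] at h2
    exact h1.trans h2

end Run

/-! ### Pumping runs into affine families -/

/-- The run from `m` in counter `i` to `m'` in counter `i'` belongs to a family of runs over an
arithmetic progression, with affine result. -/
def TCM.AffineLift (M : TCM) (q : M.Q) (i : Fin 2) (m : ℕ) (q' : M.Q) (i' : Fin 2) (m' : ℕ) :
    Prop :=
  ∃ d e : ℕ, 0 < d ∧ 0 < e ∧ ∀ t, ReflTransGen M.Step
    (q, Pi.single i (m + d * t)) (q', Pi.single i' (m' + e * t))

theorem TCM.AffineLift.trans {M : TCM} {q₁ q₂ q₃ : M.Q} {i₁ i₂ i₃ : Fin 2} {m₁ m₂ m₃ : ℕ}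
    (h : M.AffineLift q₁ i₁ m₁ q₂ i₂ m₂) (h' : M.AffineLift q₂ i₂ m₂ q₃ i₃ m₃) :
    M.AffineLift q₁ i₁ m₁ q₃ i₃ m₃ := by
  obtain ⟨d, e, hd, he, h⟩ := h
  obtain ⟨d', e', hd', he', h'⟩ := h'
  refine ⟨d * d', e * e', by positivity, by positivity, fun t => ?_⟩
  have h1 := h (d' * t)
  have h2 := h' (e * t)
  rw [show d * (d' * t) = d * d' * t by ring] at h1
  rw [show d' * (e * t) = e * (d' * t) by ring, show e' * (e * t) = e * e' * t by ring] at h2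
  exact h1.trans h2

/-- A run from one empty counter to the other, with both counters positive in between and a
large result, can be pumped. -/
theorem affineLift_of_interior_pos_of_ne {M : TCM} {c : ℕ → M.Q × Counters} {N : ℕ}
    (hc : ∀ k < N, M.Step (c k) (c (k + 1)))
    (hpos : ∀ k, 0 < k → k < N → ∀ l, (c k).2 l ≠ 0)
    {i i' : Fin 2} (hi : i ≠ i') {m m' : ℕ} (h0 : (c 0).2 = Pi.single i m)
    (hN : (c N).2 = Pi.single i' m') (hm : 0 < m) (hm' : 2 * Nat.card M.Q + 2 < m') :
    M.AffineLift (c 0).1 i m (c N).1 i' m' := by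
  have := M.finite_Q
  set C := Nat.card M.Q with hC
  have hle := run_apply_le hc (j := i') (by simp [h0, hi.symm])
  have hNC : 2 * C + 2 < N := by
    have := hle N le_rfl
    simp [hN] at this
    omega
  -- Pigeonhole on times 1, …, C + 1; time 0 is excluded because a counter is empty there.
  obtain ⟨a, L, ha0, hL, haL, hq⟩ : ∃ a L, 0 < a ∧ 0 < L ∧ a + L ≤ C + 1 ∧
      (c (a + L)).1 = (c a).1 := by
    have : ¬ Function.Injective fun k : Fin (C + 1) => (c (k + 1)).1 := fun hinj => by
      have := Nat.card_le_card_of_injective _ hinj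
      simp at this
      omega
    simp only [Function.Injective, not_forall] at this
    obtain ⟨k, l, hkl, hne⟩ := this
    have hne' : (k : ℕ) ≠ l := fun h => hne (Fin.ext h)
    have hk := k.2
    have hl := l.2
    rcases lt_or_gt_of_ne hne' with h | h
    · exact ⟨k + 1, l - k, by omega, by omega, by omega, by
        rw [show (k : ℕ) + 1 + (l - k) = l + 1 by omega]; exact hkl.symm⟩
    · exact ⟨l + 1, k - l, by omega, by omega, by omega, by
        rw [show (l : ℕ) + 1 + (k - l) = k + 1 by omega]; exact hkl⟩
  have hper := run_periodic hc (i := a) (L := L) (fun k h1 h2 => hpos k (by omega) h2) hq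
  -- The last period ends with counter `i` empty and starts with it positive.
  have hx : (c (a + L)).2 i < (c a).2 i := by
    have h1 := congrFun (hper (N - L) (by omega) (by omega)).2 i
    have h2 := hpos (N - L) (by omega) (by omega) i
    rw [show N - L + L = N by omega, hN] at h1
    simp [hi] at h1
    omega
  -- Without a gain per period, counter `i'` would never exceed its bound from the first 2C + 2
  -- steps, contradicting the size of `m'`.
  have hy : (c a).2 i' < (c (a + L)).2 i' := by
    by_contra hcon
    have key : ∀ k, k ≤ N → (c k).2 i' ≤ 2 * C + 2 := by
      intro k
      induction k using Nat.strong_induction_on with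
      | _ k ih =>
        intro hk
        by_cases hk' : k ≤ 2 * C + 2
        · exact (hle k hk).trans hk'
        · have h1 := congrFun (hper (k - L) (by omega) (by omega)).2 i'
          have h2 := ih (k - L) (by omega) (by omega)
          rw [show k - L + L = k by omega] at h1
          simp only [Pi.add_apply] at h1
          omega
    have := key N le_rfl
    simp [hN] at this
    omega
  set α := (c a).2 i - (c (a + L)).2 i with hα
  set β := (c (a + L)).2 i' - (c a).2 i' with hβ
  have hAB : (c (a + L)).2 + Pi.single i α = (c a).2 + Pi.single i' β := by
    funext l
    have hl : l = i ∨ l = i' := by omega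
    rcases hl with rfl | rfl
    · simp [hi]; omega
    · simp [hi.symm]; omega
  refine ⟨α, β, by omega, by omega, fun t => ?_⟩
  -- Carry t·α spare units to time `a`, loop t extra times to turn them into t·β, then follow the
  -- original run.
  have r1 := reflTransGen_run_shift (c := c) (Nat.zero_le a) (fun k _ h => hc k (by omega))
    (t • Pi.single i α) (by
      intro k _ hk l hl
      rcases Nat.eq_zero_or_pos k with rfl | hk0
      · have : l = i := by
          by_contra hne
          exact hl (by simp [hne])
        subst this
        simp [h0]; omega
      · exact hpos k hk0 (by omega) l)
  have r2 := reflTransGen_cycle (q := (c a).1) (n := (c a).2) (A := Pi.single i α)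
    (B := Pi.single i' β) (fun v => by
      have := reflTransGen_run_shift (c := c) (Nat.le_add_right a L)
        (fun k _ h => hc k (by omega)) (Pi.single i α + v)
        (fun k h1 h2 l _ => hpos k (by omega) (by omega) l)
      rwa [hq, ← add_assoc, ← add_assoc, hAB] at this) t 0
  have r3 := reflTransGen_run_shift (c := c) (show a ≤ N by omega) (fun k _ h => hc k h)
    (t • Pi.single i' β) (fun k h1 h2 l _ => hpos k (by omega) h2 l)
  rw [add_zero, add_zero] at r2
  have r := (r1.trans r2).trans r3
  rw [h0, hN, ← Pi.single_smul, ← Pi.single_smul, ← Pi.single_add, ← Pi.single_add] at r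
  simpa [mul_comm] using r

theorem affineLift_of_interior_pos_of_eq {M : TCM} {c : ℕ → M.Q × Counters} {N : ℕ}
    (hc : ∀ k < N, M.Step (c k) (c (k + 1)))
    (hpos : ∀ k, 0 < k → k < N → ∀ l, (c k).2 l ≠ 0)
    {i : Fin 2} {m m' : ℕ} (h0 : (c 0).2 = Pi.single i m)
    (hN : (c N).2 = Pi.single i m') (hm : 0 < m) :
    M.AffineLift (c 0).1 i m (c N).1 i m' := by
  refine ⟨1, 1, one_pos, one_pos, fun t => ?_⟩
  have r := reflTransGen_run_shift (c := c) (Nat.zero_le N) (fun k _ h => hc k h)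
    (Pi.single i t) (by
      intro k _ hk l hl
      rcases Nat.eq_zero_or_pos k with rfl | hk0
      · have : l = i := by
          by_contra hne
          exact hl (by simp [hne])
        subst this
        simp [h0]; omega
      · exact hpos k hk0 hk l)
  rw [h0, hN, ← Pi.single_add, ← Pi.single_add] at r
  simpa using r

/-- A run between configurations with an empty counter along which the counters are never both
small extends to an affine family of runs. -/
theorem affineLift_of_not_small {M : TCM} (N : ℕ) : ∀ (c : ℕ → M.Q × Counters),
    (∀ k < N, M.Step (c k) (c (k + 1))) →
    (∀ k ≤ N, ∃ l, 2 * Nat.card M.Q + 2 < (c k).2 l) →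
    ∀ {i i' : Fin 2} {m m' : ℕ}, (c 0).2 = Pi.single i m → (c N).2 = Pi.single i' m' →
    M.AffineLift (c 0).1 i m (c N).1 i' m' := by
  induction N using Nat.strong_induction_on with
  | _ N ih =>
    intro c hc hbig i i' m m' h0 hN
    -- Cut at an intermediate empty counter; affine lifts compose.
    by_cases hs : ∃ s, 0 < s ∧ s < N ∧ ∃ l, (c s).2 l = 0
    · obtain ⟨s, hs0, hsN, l, hl⟩ := hs
      obtain ⟨j, p, hp⟩ := exists_single_of_eq_zero hl
      have h1 := ih s hsN c (fun k hk => hc k (by omega)) (fun k hk => hbig k (by omega)) h0 hp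
      have h2 := ih (N - s) (Nat.sub_lt (by omega) hs0) (fun k => c (s + k)) (fun k hk => hc (s + k) (by omega))
        (fun k hk => hbig (s + k) (by omega)) hp
        (by simp only [show s + (N - s) = N by omega]; exact hN)
      simp only [show s + (N - s) = N by omega, add_zero] at h2
      exact h1.trans h2
    · push Not at hs
      have large : ∀ k ≤ N, ∀ {j : Fin 2} {p : ℕ}, (c k).2 = Pi.single j p →
          2 * Nat.card M.Q + 2 < p := by
        intro k hk j p hp
        obtain ⟨l, hl⟩ := hbig k hk
        rw [hp] at hl
        by_cases hlj : l = j
        · subst hlj; simpa using hl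
        · simp [hlj] at hl
      have hm := large 0 (by omega) h0
      have hm' := large N le_rfl hN
      by_cases hi : i = i'
      · subst hi
        exact affineLift_of_interior_pos_of_eq hc hs h0 hN (by omega)
      · exact affineLift_of_interior_pos_of_ne hc hs hi h0 hN (by omega) hm'

/-! ### Affine behaviour of unbounded computable functions -/

theorem TCM.eq_of_reflTransGen_halt {M : TCM} {a c c' : M.Q × Counters}
    (h : ReflTransGen M.Step a c) (h' : ReflTransGen M.Step a c')
    (hc : M.code c.1 = Instr.halt) (hc' : M.code c'.1 = Instr.halt) : c = c' := by
  have stuck : ∀ {x y : M.Q × Counters}, M.code x.1 = Instr.halt →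
      ReflTransGen M.Step x y → x = y := by
    intro x y hx hxy
    rcases ReflTransGen.cases_head hxy with h | ⟨z, hz, _⟩
    · exact h
    · simp [TCM.Step, hx, Instr.exec] at hz
  rcases ReflTransGen.total_of_right_unique M.step_rightUnique h h' with h | h
  · exact stuck hc h
  · exact (stuck hc' h).symm

/-- An unbounded function computed by a two-counter machine is affine and not constant on some
arithmetic progression. -/
theorem TCM.Computes.exists_affine {M : TCM} {f : ℕ → ℕ} (hM : M.Computes f)
    (hf : ¬ BddAbove (Set.range f)) :
    ∃ n d e : ℕ, 0 < d ∧ 0 < e ∧ ∀ t, f (n + d * t) = f n + e * t := by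
  have := M.finite_Q
  obtain ⟨i, hM⟩ := hM
  set S : Set (M.Q × Counters) := {x | ∀ l, x.2 l ≤ 2 * Nat.card M.Q + 2} with hS
  have hSfin : S.Finite := by
    refine (Set.finite_univ.prod (Set.finite_Iic fun _ => 2 * Nat.card M.Q + 2)).subset ?_
    exact fun x hx => ⟨Set.mem_univ _, hx⟩
  -- Outputs of runs from small configurations; by determinism each such configuration contributes
  -- at most one.
  set V : Set ℕ := {v | ∃ x ∈ S, ∃ q j, M.code q = Instr.halt ∧
    ReflTransGen M.Step x (q, Pi.single j v)} with hV
  have hVfin : V.Finite := by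
    have : V = ⋃ x ∈ S, {v | ∃ q j, M.code q = Instr.halt ∧
        ReflTransGen M.Step x (q, Pi.single j v)} := by
      ext v; simp [hV]
    rw [this]
    refine hSfin.biUnion fun x _ => Set.Subsingleton.finite ?_
    rintro v ⟨q, j, hq, hx⟩ v' ⟨q', j', hq', hx'⟩
    have := TCM.eq_of_reflTransGen_halt hx hx' hq hq'
    exact single_value_injective (congrArg Prod.snd this)
  obtain ⟨n, hn⟩ : ∃ n, f n ∉ V := by
    by_contra! hcon
    exact hf (hVfin.bddAbove.mono (by rintro _ ⟨n, rfl⟩; exact hcon n))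
  obtain ⟨⟨q, p⟩, hrun, hq, j, rfl⟩ := hM n
  obtain ⟨N, c, h0, hN, hc⟩ := exists_run_of_reflTransGen hrun
  have hlift := affineLift_of_not_small N c hc (fun k hk => by
    by_contra! hsmall
    refine hn ⟨c k, hsmall, q, j, hq, ?_⟩
    rw [← hN]
    exact reflTransGen_of_run hk fun l _ hl => hc l hl) (i := i) (m := n) (i' := j) (m' := f n)
    (by rw [h0]) (by rw [hN])
  obtain ⟨d, e, hd, he, hlift⟩ := hlift
  refine ⟨n, d, e, hd, he, fun t => ?_⟩
  obtain ⟨⟨q', p'⟩, hrun', hq', j', rfl⟩ := hM (n + d * t)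
  have hl := hlift t
  rw [h0, hN] at hl
  have := TCM.eq_of_reflTransGen_halt hrun' hl hq' hq
  exact single_value_injective (congrArg Prod.snd this)

/-! ### Machines with input -/

section Input

variable {α : Type} {M : TCMI α}

theorem TCMI.step_rightUnique (M : TCMI α) : RightUnique M.Step := by
  intro a b c hab hac
  cases hab with
  | op hq ho =>
    cases hac with
    | op hq' ho' =>
      rw [hq] at hq'
      cases hq'
      rw [ho] at ho'
      cases ho'
      rfl
    | input hq' => rw [hq] at hq'; cases hq'
  | input hq =>
    cases hac with
    | op hq' ho' => rw [hq] at hq'; cases hq'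
    | input hq' => rw [hq] at hq'; cases hq'; rfl

theorem TCMI.length_le_of_reflTransGen {x y : M.Q × Counters × List α}
    (h : ReflTransGen M.Step x y) : y.2.2.length ≤ x.2.2.length := by
  induction h with
  | refl => rfl
  | tail _ hs ih => cases hs <;> simp_all; omega

theorem TCMI.reflTransGen_append {x y : M.Q × Counters × List α}
    (h : ReflTransGen M.Step x y) (J : List α) :
    ReflTransGen M.Step (x.1, x.2.1, x.2.2 ++ J) (y.1, y.2.1, y.2.2 ++ J) := by
  induction h with
  | refl => exact .refl
  | tail _ hs ih =>
    refine ih.tail ?_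
    cases hs with
    | op hq ho => exact .op hq ho
    | input hq => exact .input hq

/-- A run that consumes more input passes through every configuration reached with less. -/
theorem TCMI.Reaches.resume {I J : List α} (hJ : J ≠ []) {w w' : M.Q} {n n' : Counters}
    (h : M.Reaches I w n) (h' : M.Reaches (I ++ J) w' n') :
    ReflTransGen M.Step (w, n, J) (w', n', []) := by
  have h1 := TCMI.reflTransGen_append h J
  simp only [List.nil_append] at h1
  rcases ReflTransGen.total_of_right_unique M.step_rightUnique h1 h' with h | h
  · exact h
  · have := TCMI.length_le_of_reflTransGen h
    simp [hJ] at this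

end Input

/-! ### Digit strings and the collision of online values -/

theorem digitValue_append {b : ℕ} (I J : List (Fin b)) :
    digitValue (I ++ J) = digitValue I + b ^ I.length * digitValue J := by
  simp [digitValue, Nat.ofDigits_append]

theorem digitValue_replicate_zero {b : ℕ} [NeZero b] (k : ℕ) :
    digitValue (List.replicate k (0 : Fin b)) = 0 := by
  simp [digitValue]

theorem exists_digitValue_eq {b : ℕ} (hb : 2 ≤ b) (n : ℕ) :
    ∃ I : List (Fin b), digitValue I = n := by
  refine ⟨(b.digits n).pmap (fun d hd => ⟨d, hd⟩) fun d hd => Nat.digits_lt_base hb hd, ?_⟩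
  simp [digitValue, List.map_pmap, Nat.ofDigits_digits]

/-- For an online computable function, appending a fixed block of digits after an arbitrary
number of zeros takes some value more than once. -/
theorem TCMI.ComputesOnline.exists_value_eq {b : ℕ} [NeZero b] {M : TCMI (Fin b)} {f : ℕ → ℕ}
    (hM : M.ComputesOnline f) (I J : List (Fin b)) (hJ : J ≠ []) :
    ∃ k l, k ≠ l ∧ f (digitValue I + b ^ (I.length + k) * digitValue J) =
      f (digitValue I + b ^ (I.length + l) * digitValue J) := by
  have := M.finite_Q
  have hval : ∀ k, digitValue (I ++ List.replicate k 0) = digitValue I := fun k => by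
    simp [digitValue_append, digitValue_replicate_zero]
  have hval' : ∀ k, digitValue (I ++ List.replicate k 0 ++ J) =
      digitValue I + b ^ (I.length + k) * digitValue J := fun k => by
    rw [digitValue_append, hval]; simp
  choose w j hw using fun k => hM (I ++ List.replicate k 0)
  choose w' j' hw' using fun k => hM (I ++ List.replicate k 0 ++ J)
  simp only [hval] at hw
  simp only [hval'] at hw'
  -- The counter value is the same for every padding, so only line and counter index vary.
  obtain ⟨⟨q, i⟩, hinf⟩ := Finite.exists_infinite_fiber fun k => (w k, j k)
  set K : Set ℕ := (fun k => (w k, j k)) ⁻¹' {(q, i)} with hK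
  have hKinf : K.Infinite := Set.infinite_coe_iff.mp hinf
  have hreach : ∀ k ∈ K, M.Reaches (I ++ List.replicate k 0) q (Pi.single i (f (digitValue I))) := by
    intro k hk
    have hk : (w k, j k) = (q, i) := hk
    have h := hw k
    rw [(Prod.mk.inj hk).1, (Prod.mk.inj hk).2] at h
    exact h
  -- The extra 0 must eventually be consumed, so only finitely many configurations precede that end;
  -- every `x k` with `k ∈ K` still has the 0 unread and is among them.
  set a : M.Q × Counters × List (Fin b) := (q, Pi.single i (f (digitValue I)), J ++ [0]) with ha
  let x : ℕ → M.Q × Counters × List (Fin b) := fun k =>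
    (w' k, Pi.single (j' k) (f (digitValue I + b ^ (I.length + k) * digitValue J)), [0])
  obtain ⟨k₀, hk₀⟩ := hKinf.nonempty
  obtain ⟨we, je, hend⟩ := hM (I ++ List.replicate k₀ 0 ++ (J ++ [0]))
  have hend := (hreach k₀ hk₀).resume (by simp) hend
  have hmaps : Set.MapsTo x K {y | ReflTransGen M.Step a y ∧ ¬ ReflTransGen M.Step
      (we, Pi.single je (f (digitValue (I ++ List.replicate k₀ 0 ++ (J ++ [0])))), []) y} := by
    intro k hk
    refine ⟨?_, fun h => ?_⟩
    · simpa using TCMI.reflTransGen_append ((hreach k hk).resume hJ (hw' k)) [0]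
    · simpa [x] using TCMI.length_le_of_reflTransGen h
  obtain ⟨k, _, l, _, hne, heq⟩ := hKinf.exists_ne_map_eq_of_mapsTo hmaps
    (finite_setOf_reached_before M.step_rightUnique hend)
  exact ⟨k, l, hne, single_value_injective (congrArg (fun y => y.2.1) heq)⟩

end MinskyInput

open MinskyInput in
theorem mainTheorem4 (f : ℕ → ℕ) (hf : ¬ BddAbove (Set.range f))
    (hM : ∃ M : MinskyInput.TCM, M.Computes f) (b : ℕ) (hb : 2 ≤ b) :
    ¬ ∃ M : MinskyInput.TCMI (Fin b), M.ComputesOnline f := by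
  rintro ⟨N, hN⟩
  obtain ⟨M, hM⟩ := hM
  have : NeZero b := ⟨by omega⟩
  obtain ⟨n, d, e, hd, he, hnd⟩ := hM.exists_affine hf
  obtain ⟨I, rfl⟩ := exists_digitValue_eq hb n
  obtain ⟨J, rfl⟩ := exists_digitValue_eq hb d
  have hJ : J ≠ [] := by
    rintro rfl
    simp [digitValue] at hd
  obtain ⟨k, l, hkl, h⟩ := hN.exists_value_eq I J hJ
  -- Both arguments lie on the progression, with powers of `b` as parameters.
  rw [mul_comm _ (digitValue J), mul_comm _ (digitValue J), hnd, hnd] at h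
  have h1 := Nat.eq_of_mul_eq_mul_left he (Nat.add_left_cancel h)
  have h2 := Nat.pow_right_injective hb h1
  exact hkl (by omega)
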